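/- For a simple graph $G$ with vertex set $\{1,\dots,n\}$ let $S(G)$ be the set of all real symmetric $n\times n$ matrices $A=(a_{ij})$ such that, for $i\neq j$, $a_{ij}\neq 0$ if and only if $ij$ is an edge of $G$ (the diagonal entries are arbitrary), and let $q(G)=\min\{q(A): A\in S(G)\}$, where $q(A)$ is the number of distinct eigenvalues of $A$. For a binary sequence $(b_1,\dots,b_n)$, the threshold graph with creation sequence $(b_1,\dots,b_n)$ is the graph on $v_1,\dots,v_n$ in which, for $i<j$, $v_i$ and $v_j$ are adjacent if and only if $b_j=1$; we write $G\cong(b_1,\dots,b_n)$ if $G$ is isomorphic to it. **Theorem.** There is a constant $C$ such that the following holds for all integers $s\ge 1$ and $k_1,t_1,\dots,k_s,t_s\ge 1$. If $$G\cong(\underbrace{0,\ldots,0}_{k_1},\underbrace{1,\ldots,1}_{t_1},\underbrace{0,\ldots,0}_{k_2},\underbrace{1,\ldots,1}_{t_2},\ldots,\underbrace{0,\ldots,0}_{k_s},\underbrace{1,\ldots,1}_{t_s})$$ is a (necessarily connected) threshold graph on $n$ vertices, then $$q(G)\le\left\lfloor\frac{s+9}{2}\right\rfloor\qquad\text{and}\qquad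 q(G)\le\frac n4+C.$$ -/

import Mathlib

/-- The set `S(G)` of symmetric matrices described by `G`: all real symmetric matrices indexed by
the vertices whose off-diagonal nonzero entries are exactly those at the edges of `G`
(the diagonal is free). -/
def SimpleGraph.describedMatrices {V : Type*} (G : SimpleGraph V) : Set (Matrix V V ℝ) :=
  {A | A.IsSymm ∧ ∀ i j, i ≠ j → (A i j ≠ 0 ↔ G.Adj i j)}

/-- `S(G)` is never empty: it contains the adjacency matrix. -/
theorem SimpleGraph.describedMatrices_nonempty {V : Type*} (G : SimpleGraph V) :
    G.describedMatrices.Nonempty := by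
  classical
  refine ⟨G.adjMatrix ℝ, G.isSymm_adjMatrix, fun i j _ => ?_⟩
  simp [SimpleGraph.adjMatrix_apply]

/-- `q(A)`: the number of distinct (real) eigenvalues of a real square matrix. -/
noncomputable def Matrix.numDistinctEigenvalues {V : Type*} [Fintype V] [DecidableEq V]
    (A : Matrix V V ℝ) : ℕ :=
  Set.ncard {μ : ℝ | Module.End.HasEigenvalue (Matrix.toLin' A) μ}

/-- `q(G) = min {q(A) : A ∈ S(G)}`, the minimum number of distinct eigenvalues of the graph `G`.
The set below is a nonempty set of natural numbers, so the infimum is a minimum. -/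
noncomputable def SimpleGraph.minDistinctEigenvalues {V : Type*} [Fintype V] [DecidableEq V]
    (G : SimpleGraph V) : ℕ :=
  sInf (Matrix.numDistinctEigenvalues '' G.describedMatrices)

/-- The minimum in the definition of `q(G)` is attained. -/
theorem SimpleGraph.exists_numDistinctEigenvalues_eq {V : Type*} [Fintype V] [DecidableEq V]
    (G : SimpleGraph V) :
    ∃ A ∈ G.describedMatrices, A.numDistinctEigenvalues = G.minDistinctEigenvalues :=
  Nat.sInf_mem (G.describedMatrices_nonempty.image Matrix.numDistinctEigenvalues)

/-- The threshold graph with creation sequence `b = (b₁, …, bₙ)`, where `true` stands for `1`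
(dominating) and `false` for `0` (isolated): when the vertex `j` is added, it is joined to all
earlier vertices if `bⱼ = 1` and to none of them if `bⱼ = 0`. So two distinct vertices are adjacent
if and only if the one added later is dominating. -/
def thresholdGraph (b : List Bool) : SimpleGraph (Fin b.length) where
  Adj i j := i ≠ j ∧ b.get (max i j) = true
  symm := ⟨fun i j h => ⟨h.1.symm, by rw [max_comm]; exact h.2⟩⟩
  loopless := ⟨fun _ h => h.1 rfl⟩

/-- The sequence of `k₁` zeros, `t₁` ones, `k₂` zeros, `t₂` ones, …, `kₛ` zeros, `tₛ` ones. -/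
def blockSequence {s : ℕ} (k t : Fin s → ℕ) : List Bool :=
  (List.ofFn fun i => List.replicate (k i) false ++ List.replicate (t i) true).flatten

/-!
Every connected threshold graph `G` satisfies `q(G) ≤ 4`; both bounds follow, since
`⌊(s + 9) / 2⌋ ≥ 4`, and `C = 4` works in the second one.

The vertices fall into `2s` cells, the maximal runs of equal symbols in the creation sequence. Let
`L` be the upper triangular Cholesky factor of `1 + J`, where `J` is the all-ones matrix of order
`s`: it is given by an explicit formula (`choleskyEntry`), and all its entries on and above the
diagonal are positive. The matrix `Q = [[0, L], [Lᵀ, -J]]` of order `2s` then has the zero pattern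
of the threshold graph `(0, 1, 0, 1, …, 0, 1)`. If `Q (x, y) = λ (x, y)`, then eliminating `x`
gives `(1 + J) y - λ J y = λ² y`, that is, `(λ - 1) ((λ + 1) y + J y) = 0`, which forces
`λ ∈ {0, 1, -1, -(s + 1)}` (`eigenvalue_quotientMatrix`).

Finally `Q` is spread over the cells (`Matrix.blowUp`): every entry of `Q - diag d` becomes a
constant block, and on each cell the multiple of the identity given by `d` is added. Every
eigenvalue of the result is an eigenvalue of `Q` or a value of `d` (`Matrix.eigenvalue_blowUp`). With `d = 0` on the cells of zeros
and `d = 1` on the cells of ones, the former stay independent, the latter become cliques because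
the diagonal entries `-1` of `-J` differ from `1`, and no new eigenvalue besides `0` and `1` appears.
-/

open scoped Matrix

/-! ### Blow-ups of a matrix along a partition -/

/-- The blow-up of `Q` along the partition of `V` into the fibres of `f`: on the span of the
normalized indicator vectors of the fibres it acts as `Q`, and on vectors supported in the fibre of
`i` with coordinate sum zero it acts as the scalar `d i`. -/
noncomputable def Matrix.blowUp {V ι : Type*} [Fintype V] [DecidableEq V] [DecidableEq ι]
    (f : V → ι) (d : ι → ℝ) (Q : Matrix ι ι ℝ) : Matrix V V ℝ :=
  Matrix.diagonal (d ∘ f) + Matrix.of fun u v =>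
    (Q - Matrix.diagonal d) (f u) (f v) /
      (√(Finset.univ.filter fun w => f w = f u).card *
        √(Finset.univ.filter fun w => f w = f v).card)

/-- An eigenvector of the blow-up either has nonzero sum on some fibre, and then its normalized fibre
sums form an eigenvector of `Q`, or is an eigenvector of the diagonal part alone. -/
theorem Matrix.eigenvalue_blowUp {V ι : Type*} [Fintype V] [DecidableEq V] [Fintype ι]
    [DecidableEq ι] {f : V → ι} (hf : Function.Surjective f) {d : ι → ℝ} {Q : Matrix ι ι ℝ}
    {r : ℝ} {x : V → ℝ} (hx : x ≠ 0) (h : Matrix.blowUp f d Q *ᵥ x = r • x) :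
    (∃ i, r = d i) ∨ ∃ y : ι → ℝ, y ≠ 0 ∧ Q *ᵥ y = r • y := by
  classical
  set m : ι → ℝ := fun i => √(Finset.univ.filter fun w => f w = i).card with hm
  have hm0 : ∀ i, m i ≠ 0 := by
    intro i
    obtain ⟨u, hu⟩ := hf i
    have : 0 < (Finset.univ.filter fun w => f w = i).card :=
      Finset.card_pos.mpr ⟨u, by simp [hu]⟩
    exact (Real.sqrt_pos.mpr (by exact_mod_cast this)).ne'
  -- The component of `x` along the normalized indicator vectors of the fibres.
  set y : ι → ℝ := fun i => (∑ v with f v = i, x v) / m i with hy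
  have key : ∀ u, (r - d (f u)) * x u = ((Q - Matrix.diagonal d) *ᵥ y) (f u) / m (f u) := by
    intro u
    have hu := congrFun h u
    simp only [Matrix.blowUp, Matrix.add_mulVec, Pi.add_apply, Matrix.mulVec_diagonal,
      Function.comp, Pi.smul_apply, smul_eq_mul] at hu
    have hsum : ((Q - Matrix.diagonal d) *ᵥ y) (f u) / m (f u) =
        ∑ v, (Q - Matrix.diagonal d) (f u) (f v) / (m (f u) * m (f v)) * x v := by
      rw [← Finset.sum_fiberwise Finset.univ f]
      simp only [Matrix.mulVec, dotProduct, Finset.sum_div]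
      refine Finset.sum_congr rfl fun i _ => ?_
      rw [hy, ← mul_div_assoc, Finset.mul_sum, Finset.sum_div, Finset.sum_div]
      refine Finset.sum_congr rfl fun v hv => ?_
      rw [(Finset.mem_filter.mp hv).2]
      field_simp [hm0]
    rw [hsum, sub_mul, ← hu]
    simp only [Matrix.mulVec, dotProduct, Matrix.of_apply, hm]
    ring
  have hQ : Q *ᵥ y = r • y := by
    funext i
    have h1 : (r - d i) * y i = ((Q - Matrix.diagonal d) *ᵥ y) i := by
      have h2 : (r - d i) * ∑ v with f v = i, x v =
          ∑ v with f v = i, ((Q - Matrix.diagonal d) *ᵥ y) i / m i := by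
        rw [Finset.mul_sum]
        refine Finset.sum_congr rfl fun v hv => ?_
        have := key v
        rwa [(Finset.mem_filter.mp hv).2] at this
      rw [Finset.sum_const, nsmul_eq_mul] at h2
      have h3 : ((Finset.univ.filter fun w => f w = i).card : ℝ) = m i * m i :=
        (Real.mul_self_sqrt (Nat.cast_nonneg _)).symm
      rw [h3] at h2
      have := hm0 i
      have h4 : y i = (∑ v with f v = i, x v) / m i := rfl
      rw [h4, ← mul_div_assoc, h2]
      field_simp
    rw [Matrix.sub_mulVec, Pi.sub_apply, Matrix.mulVec_diagonal] at h1
    simp only [Pi.smul_apply, smul_eq_mul]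
    linarith
  by_cases hy0 : y = 0
  · left
    obtain ⟨u, hu⟩ := Function.ne_iff.mp hx
    have := key u
    rw [hy0, Matrix.mulVec_zero, Pi.zero_apply, zero_div] at this
    exact ⟨f u, sub_eq_zero.mp ((mul_eq_zero.mp this).resolve_right hu)⟩
  · exact Or.inr ⟨y, hy0, hQ⟩

/-! ### The quotient matrix -/

/-- The entries of the Cholesky factor of `1 + J`, where `J` is an all-ones matrix; rows and columns
are numbered from `0`. -/
noncomputable def choleskyEntry (i j : ℕ) : ℝ :=
  if i < j then 1 / √((i + 1) * (i + 2)) else if i = j then √(i + 2) / √(i + 1) else 0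

theorem choleskyEntry_ne_zero_iff (i j : ℕ) : choleskyEntry i j ≠ 0 ↔ i ≤ j := by
  have h1 : √((i : ℝ) + 1) ≠ 0 := (Real.sqrt_pos.mpr (by positivity)).ne'
  have h2 : √((i : ℝ) + 2) ≠ 0 := (Real.sqrt_pos.mpr (by positivity)).ne'
  have h3 : √(((i : ℝ) + 1) * (i + 2)) ≠ 0 := (Real.sqrt_pos.mpr (by positivity)).ne'
  unfold choleskyEntry
  split_ifs with h h'
  · simpa [h3] using h.le
  · subst h'
    simp [h1, h2]
  · simp only [ne_eq, not_true_eq_false, false_iff]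
    omega

theorem sum_range_one_div_mul_succ (j : ℕ) :
    ∑ i ∈ Finset.range j, 1 / (((i : ℝ) + 1) * (i + 2)) = 1 - 1 / ((j : ℝ) + 1) := by
  induction j with
  | zero => simp
  | succ j ih =>
    rw [Finset.sum_range_succ, ih]
    have h1 : (j : ℝ) + 1 ≠ 0 := by positivity
    have h2 : (j : ℝ) + 2 ≠ 0 := by positivity
    have h3 : (j : ℝ) + 1 + 1 ≠ 0 := by positivity
    push_cast
    field_simp
    ring

theorem sum_range_choleskyEntry_mul {s j l : ℕ} (hj : j < s) (hjl : j ≤ l) :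
    ∑ i ∈ Finset.range s, choleskyEntry i j * choleskyEntry i l = if j = l then 2 else 1 := by
  have hsub : Finset.range (j + 1) ⊆ Finset.range s := Finset.range_subset_range.mpr hj
  rw [← Finset.sum_subset hsub, Finset.sum_range_succ]
  · have h1 : ∑ i ∈ Finset.range j, choleskyEntry i j * choleskyEntry i l =
        ∑ i ∈ Finset.range j, 1 / (((i : ℝ) + 1) * (i + 2)) := by
      refine Finset.sum_congr rfl fun i hi => ?_
      have hij := Finset.mem_range.mp hi
      rw [choleskyEntry, choleskyEntry, if_pos hij, if_pos (hij.trans_le hjl), div_mul_div_comm,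
        Real.mul_self_sqrt (by positivity), one_mul]
    have hp : (0 : ℝ) < j + 1 := by positivity
    have hq : (0 : ℝ) < j + 2 := by positivity
    have hp' := (Real.sqrt_pos.mpr hp).ne'
    have hq' := (Real.sqrt_pos.mpr hq).ne'
    rw [h1, sum_range_one_div_mul_succ]
    rcases hjl.eq_or_lt with rfl | hlt
    · rw [choleskyEntry, if_neg (lt_irrefl j), if_pos rfl, if_pos rfl, div_mul_div_comm,
        Real.mul_self_sqrt hp.le, Real.mul_self_sqrt hq.le]
      field_simp
      ring
    · rw [choleskyEntry, choleskyEntry, if_neg (lt_irrefl j), if_pos rfl, if_pos hlt,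
        if_neg hlt.ne, Real.sqrt_mul hp.le]
      have : √((j : ℝ) + 2) / √((j : ℝ) + 1) * (1 / (√((j : ℝ) + 1) * √((j : ℝ) + 2))) =
          1 / (√((j : ℝ) + 1) * √((j : ℝ) + 1)) := by
        field_simp
      rw [this, Real.mul_self_sqrt hp.le]
      ring
  · intro i _ hi
    have : ¬ i ≤ j := by simpa [Nat.lt_succ_iff] using hi
    rw [not_ne_iff.mp (mt (choleskyEntry_ne_zero_iff i j).mp this), zero_mul]

theorem sum_choleskyEntry_mul {s : ℕ} (j l : Fin s) :
    ∑ i : Fin s, choleskyEntry i j * choleskyEntry i l = (if j = l then 1 else 0) + 1 := by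
  rw [Fin.sum_univ_eq_sum_range (fun i => choleskyEntry i j * choleskyEntry i l)]
  rcases le_total j l with h | h
  · rw [sum_range_choleskyEntry_mul j.2 h]
    by_cases hjl : j = l
    · norm_num [hjl]
    · simp [hjl, Fin.val_inj]
  · simp_rw [mul_comm (choleskyEntry _ (j : ℕ))]
    rw [sum_range_choleskyEntry_mul l.2 h]
    by_cases hjl : j = l
    · norm_num [hjl]
    · simp [hjl, Ne.symm hjl, Fin.val_inj]

/-- The matrix `[[0, L], [Lᵀ, -J]]`, where `L` is the Cholesky factor of `1 + J`. The index `inl i`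
stands for the `i`-th cell of zeros of a threshold graph, `inr i` for the `i`-th cell of ones. -/
noncomputable def quotientMatrix (s : ℕ) : Matrix (Fin s ⊕ Fin s) (Fin s ⊕ Fin s) ℝ :=
  Matrix.fromBlocks 0 (Matrix.of fun i j => choleskyEntry i j)
    (Matrix.of fun i j => choleskyEntry j i) (Matrix.of fun _ _ => -1)

theorem quotientMatrix_symm {s : ℕ} (a b : Fin s ⊕ Fin s) :
    quotientMatrix s a b = quotientMatrix s b a := by
  rcases a with i | i <;> rcases b with j | j <;> simp [quotientMatrix]

theorem eigenvalue_quotientMatrix {s : ℕ} {r : ℝ} {z : Fin s ⊕ Fin s → ℝ} (hz : z ≠ 0)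
    (h : quotientMatrix s *ᵥ z = r • z) : r = 0 ∨ r = 1 ∨ r = -1 ∨ r = -(s + 1) := by
  set S : ℝ := ∑ j, z (Sum.inr j) with hS
  have hl : ∀ i : Fin s, ∑ j : Fin s, choleskyEntry i j * z (Sum.inr j) = r * z (Sum.inl i) := by
    intro i
    simpa [quotientMatrix, Matrix.mulVec, dotProduct] using congrFun h (Sum.inl i)
  have hr : ∀ j : Fin s, ∑ i : Fin s, choleskyEntry i j * z (Sum.inl i) - S =
      r * z (Sum.inr j) := by
    intro j
    simpa [quotientMatrix, Matrix.mulVec, dotProduct, ← sub_eq_add_neg] using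
      congrFun h (Sum.inr j)
  have hLL : ∀ j : Fin s, ∑ i : Fin s, choleskyEntry i j * (r * z (Sum.inl i)) =
      z (Sum.inr j) + S := by
    intro j
    simp_rw [← hl, Finset.mul_sum]
    rw [Finset.sum_comm]
    simp_rw [← mul_assoc, ← Finset.sum_mul, sum_choleskyEntry_mul, add_mul, one_mul,
      Finset.sum_add_distrib, ite_mul, one_mul, zero_mul]
    simp [hS]
  -- Eliminating the `inl` part by `Lᵀ L = 1 + J` leaves a quadratic equation that factors.
  have hfac : ∀ j : Fin s, (r - 1) * ((r + 1) * z (Sum.inr j) + S) = 0 := by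
    intro j
    have h1 : r * ∑ i : Fin s, choleskyEntry i j * z (Sum.inl i) = z (Sum.inr j) + S := by
      rw [← hLL, Finset.mul_sum]
      exact Finset.sum_congr rfl fun i _ => by ring
    have h2 : ∑ i : Fin s, choleskyEntry i j * z (Sum.inl i) = r * z (Sum.inr j) + S := by
      linarith [hr j]
    rw [h2] at h1
    linear_combination h1
  by_cases h1 : r = 1
  · exact Or.inr (Or.inl h1)
  have hy : ∀ j : Fin s, (r + 1) * z (Sum.inr j) + S = 0 := fun j =>
    (mul_eq_zero.mp (hfac j)).resolve_left (sub_ne_zero.mpr h1)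
  have hsum : (r + 1 + s) * S = 0 := by
    have := Finset.sum_eq_zero fun j (_ : j ∈ Finset.univ) => hy j
    rw [Finset.sum_add_distrib, ← Finset.mul_sum, ← hS] at this
    simp only [Finset.sum_const, Finset.card_univ, Fintype.card_fin, nsmul_eq_mul] at this
    linarith
  rcases mul_eq_zero.mp hsum with h2 | h2
  · exact Or.inr (Or.inr (Or.inr (by linarith)))
  by_cases h3 : r = -1
  · exact Or.inr (Or.inr (Or.inl h3))
  have hy0 : ∀ j : Fin s, z (Sum.inr j) = 0 := by
    intro j
    have h4 := hy j
    rw [h2, add_zero] at h4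
    exact (mul_eq_zero.mp h4).resolve_left fun h5 => h3 (by linarith)
  left
  by_contra h0
  refine hz (funext fun a => ?_)
  rcases a with i | j
  · have := hl i
    simp only [hy0, mul_zero, Finset.sum_const_zero] at this
    exact (mul_eq_zero.mp this.symm).resolve_left h0
  · exact hy0 j

/-! ### Cells of a threshold graph -/

/-- Adjacency between distinct vertices of two cells of a threshold graph; `inl i` is the `i`-th cell
of zeros, `inr i` the `i`-th cell of ones. -/
def cellAdj {s : ℕ} : Fin s ⊕ Fin s → Fin s ⊕ Fin s → Prop
  | Sum.inl _, Sum.inl _ => False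
  | Sum.inl i, Sum.inr j => i ≤ j
  | Sum.inr j, Sum.inl i => i ≤ j
  | Sum.inr _, Sum.inr _ => True

theorem cellAdj_symm {s : ℕ} (a b : Fin s ⊕ Fin s) : cellAdj a b ↔ cellAdj b a := by
  rcases a with i | i <;> rcases b with j | j <;> simp [cellAdj]

/-- The position of a cell in the creation sequence. -/
def cellPosition {s : ℕ} : Fin s ⊕ Fin s → ℕ :=
  Sum.elim (fun i => 2 * i) (fun i => 2 * i + 1)

theorem cellAdj_iff_of_le {s : ℕ} {a b : Fin s ⊕ Fin s} (h : cellPosition a ≤ cellPosition b) :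
    cellAdj a b ↔ b.isRight = true := by
  rcases a with i | i <;> rcases b with j | j <;>
    simp only [cellPosition, Sum.elim_inl, Sum.elim_inr] at h <;>
    simp only [cellAdj, Sum.isRight_inl, Sum.isRight_inr, Fin.le_def, iff_true, Bool.false_eq_true,
      iff_false] <;>
    omega

/-- The list of the cells of the successive vertices of a threshold graph. -/
def cellSequence {s : ℕ} (k t : Fin s → ℕ) : List (Fin s ⊕ Fin s) :=
  (List.ofFn fun i =>
    List.replicate (k i) (Sum.inl i) ++ List.replicate (t i) (Sum.inr i)).flatten

theorem map_isRight_cellSequence {s : ℕ} (k t : Fin s → ℕ) :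
    (cellSequence k t).map Sum.isRight = blockSequence k t := by
  simp [cellSequence, blockSequence, List.map_flatten, List.map_ofFn, Function.comp_def]

theorem pairwise_cellSequence {s : ℕ} (k t : Fin s → ℕ) :
    (cellSequence k t).Pairwise fun a b => cellPosition a ≤ cellPosition b := by
  rw [cellSequence, List.pairwise_flatten]
  constructor
  · intro l hl
    obtain ⟨i, rfl⟩ := List.mem_ofFn.mp hl
    rw [List.pairwise_append]
    refine ⟨List.pairwise_replicate.mpr (Or.inr le_rfl),
      List.pairwise_replicate.mpr (Or.inr le_rfl), fun a ha b hb => ?_⟩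
    rw [List.eq_of_mem_replicate ha, List.eq_of_mem_replicate hb]
    simp [cellPosition]
  · rw [List.pairwise_ofFn]
    intro i j hij a ha b hb
    have hij' : (i : ℕ) < j := hij
    rcases List.mem_append.mp ha with ha | ha <;> rcases List.mem_append.mp hb with hb | hb <;>
      rw [List.eq_of_mem_replicate ha, List.eq_of_mem_replicate hb] <;>
      simp only [cellPosition, Sum.elim_inl, Sum.elim_inr] <;> omega

theorem mem_cellSequence {s : ℕ} {k t : Fin s → ℕ} (hk : ∀ i, 1 ≤ k i) (ht : ∀ i, 1 ≤ t i)
    (a : Fin s ⊕ Fin s) : a ∈ cellSequence k t := by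
  rw [cellSequence, List.mem_flatten]
  rcases a with i | i
  · exact ⟨_, List.mem_ofFn.mpr ⟨i, rfl⟩, List.mem_append_left _
      (List.mem_replicate.mpr ⟨(Nat.one_le_iff_ne_zero.mp (hk i)), rfl⟩)⟩
  · exact ⟨_, List.mem_ofFn.mpr ⟨i, rfl⟩, List.mem_append_right _
      (List.mem_replicate.mpr ⟨(Nat.one_le_iff_ne_zero.mp (ht i)), rfl⟩)⟩

/-- The map sending each vertex to its cell. Positivity of the `k i` and `t i` makes it
surjective. -/
theorem exists_cell_thresholdGraph {s : ℕ} {k t : Fin s → ℕ} (hk : ∀ i, 1 ≤ k i)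
    (ht : ∀ i, 1 ≤ t i) :
    ∃ f : Fin (blockSequence k t).length → Fin s ⊕ Fin s, Function.Surjective f ∧
      ∀ u v, (thresholdGraph (blockSequence k t)).Adj u v ↔ u ≠ v ∧ cellAdj (f u) (f v) := by
  have hlen : (blockSequence k t).length = (cellSequence k t).length := by
    rw [← map_isRight_cellSequence, List.length_map]
  have hget : ∀ u : Fin (blockSequence k t).length,
      (blockSequence k t).get u = ((cellSequence k t).get (u.cast hlen)).isRight := by
    intro u
    simp only [List.get_eq_getElem, ← map_isRight_cellSequence, List.getElem_map, Fin.val_cast]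
  refine ⟨fun u => (cellSequence k t).get (u.cast hlen), fun a => ?_, ?_⟩
  · obtain ⟨w, hw⟩ := List.get_of_mem (mem_cellSequence hk ht a)
    exact ⟨w.cast hlen.symm, hw⟩
  · have main : ∀ u v : Fin (blockSequence k t).length, u < v →
        ((blockSequence k t).get (max u v) = true ↔ cellAdj
          ((cellSequence k t).get (u.cast hlen)) ((cellSequence k t).get (v.cast hlen))) := by
      intro u v huv
      rw [max_eq_right huv.le, hget, cellAdj_iff_of_le]
      exact List.pairwise_iff_get.mp (pairwise_cellSequence k t) _ _ huv
    intro u v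
    refine and_congr_right fun hne => ?_
    rcases lt_or_gt_of_ne hne with huv | huv
    · exact main u v huv
    · rw [max_comm, cellAdj_symm]
      exact main v u huv

/-! ### Four distinct eigenvalues suffice -/

theorem SimpleGraph.minDistinctEigenvalues_le_of_mem {V : Type*} [Fintype V] [DecidableEq V]
    {G : SimpleGraph V} {A : Matrix V V ℝ} (hA : A ∈ G.describedMatrices) (S : Finset ℝ)
    (hS : ∀ (r : ℝ) (x : V → ℝ), x ≠ 0 → A *ᵥ x = r • x → r ∈ S) :
    G.minDistinctEigenvalues ≤ S.card := by
  refine (Nat.sInf_le (Set.mem_image_of_mem Matrix.numDistinctEigenvalues hA)).trans ?_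
  rw [Matrix.numDistinctEigenvalues, ← Set.ncard_coe_finset]
  refine Set.ncard_le_ncard (fun r hr => ?_) S.finite_toSet
  obtain ⟨x, hx⟩ := Module.End.HasEigenvalue.exists_hasEigenvector hr
  exact hS r x hx.2 (by simpa using hx.apply_eq_smul)

theorem minDistinctEigenvalues_le_four {V : Type*} [Fintype V] [DecidableEq V] {s : ℕ}
    {G : SimpleGraph V} {f : V → Fin s ⊕ Fin s} (hf : Function.Surjective f)
    (hG : ∀ u v, G.Adj u v ↔ u ≠ v ∧ cellAdj (f u) (f v)) :
    G.minDistinctEigenvalues ≤ 4 := by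
  classical
  set d : Fin s ⊕ Fin s → ℝ := Sum.elim (fun _ => 0) (fun _ => 1) with hd
  have hpat : ∀ a b, (quotientMatrix s - Matrix.diagonal d) a b ≠ 0 ↔ cellAdj a b := by
    intro a b
    rcases a with i | i <;> rcases b with j | j
    · by_cases hij : i = j <;> simp [quotientMatrix, hd, cellAdj, hij]
    · simpa [quotientMatrix, cellAdj, Matrix.diagonal_apply] using choleskyEntry_ne_zero_iff i j
    · simpa [quotientMatrix, cellAdj, Matrix.diagonal_apply] using choleskyEntry_ne_zero_iff j i
    · by_cases hij : i = j <;>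
        norm_num [quotientMatrix, hd, cellAdj, Matrix.diagonal_apply, hij]
  have hA : Matrix.blowUp f d (quotientMatrix s) ∈ G.describedMatrices := by
    refine ⟨Matrix.IsSymm.ext fun u v => ?_, fun u v huv => ?_⟩
    · have h1 : (quotientMatrix s - Matrix.diagonal d) (f v) (f u) =
          (quotientMatrix s - Matrix.diagonal d) (f u) (f v) := by
        rw [Matrix.sub_apply, Matrix.sub_apply, quotientMatrix_symm,
          ← Matrix.diagonal_transpose d, Matrix.transpose_apply, Matrix.diagonal_transpose]
      have h2 : Matrix.diagonal (d ∘ f) v u = Matrix.diagonal (d ∘ f) u v := by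
        rw [← Matrix.diagonal_transpose, Matrix.transpose_apply, Matrix.diagonal_transpose]
      simp only [Matrix.blowUp, Matrix.add_apply, Matrix.of_apply, h1, h2]
      rw [mul_comm (√_)]
    · have hpos : ∀ w, √((Finset.univ.filter fun w' => f w' = f w).card : ℝ) ≠ 0 := by
        intro w
        have : 0 < (Finset.univ.filter fun w' => f w' = f w).card :=
          Finset.card_pos.mpr ⟨w, by simp⟩
        exact (Real.sqrt_pos.mpr (by exact_mod_cast this)).ne'
      rw [hG, Matrix.blowUp, Matrix.add_apply, Matrix.diagonal_apply_ne _ huv, zero_add,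
        Matrix.of_apply, div_ne_zero_iff, hpat]
      simp only [ne_eq, huv, not_false_eq_true, true_and, and_iff_left_iff_imp]
      exact fun _ => mul_ne_zero (hpos u) (hpos v)
  refine (SimpleGraph.minDistinctEigenvalues_le_of_mem hA {0, 1, -1, -((s : ℝ) + 1)}
    fun r x hx hr => ?_).trans Finset.card_le_four
  simp only [Finset.mem_insert, Finset.mem_singleton]
  rcases Matrix.eigenvalue_blowUp hf hx hr with ⟨a, ha⟩ | ⟨y, hy, hQ⟩
  · rcases a with i | i
    · exact Or.inl ha
    · exact Or.inr (Or.inl ha)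
  · exact eigenvalue_quotientMatrix hy hQ

theorem mainTheorem3 :
    ∃ C : ℝ, ∀ (n s : ℕ) (k t : Fin s → ℕ) (G : SimpleGraph (Fin n)),
      1 ≤ s → (∀ i, 1 ≤ k i) → (∀ i, 1 ≤ t i) →
      Nonempty (G ≃g thresholdGraph (blockSequence k t)) →
        G.minDistinctEigenvalues ≤ ⌊((s : ℝ) + 9) / 2⌋₊ ∧
        (G.minDistinctEigenvalues : ℝ) ≤ (n : ℝ) / 4 + C := by
  refine ⟨4, fun n s k t G _ hk ht ⟨e⟩ => ?_⟩
  obtain ⟨f, hf, hadj⟩ := exists_cell_thresholdGraph hk ht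
  have h4 : G.minDistinctEigenvalues ≤ 4 := by
    refine minDistinctEigenvalues_le_four (f := f ∘ e) (hf.comp e.surjective) fun u v => ?_
    rw [← e.map_adj_iff, hadj, e.injective.ne_iff]
    rfl
  refine ⟨h4.trans (Nat.le_floor ?_), ?_⟩
  · have : (0 : ℝ) ≤ s := Nat.cast_nonneg s
    push_cast
    linarith
  · have h4' : (G.minDistinctEigenvalues : ℝ) ≤ 4 := by exact_mod_cast h4
    have : (0 : ℝ) ≤ n := Nat.cast_nonneg n
    linarith
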